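/- Let $V$ be a finite-dimensional real Euclidean space, and let $W \subset O(V)$ be a finite reflection group, i.e. a finite subgroup generated by orthogonal reflections. For $0\neq\alpha\in V$ let $s_\alpha$ be the orthogonal reflection fixing $\alpha^\perp$ pointwise. Let $\Phi$ be a root system for $W$: a finite set of nonzero vectors, stable under $W$, with $\mathbb R\alpha\cap\Phi=\{\alpha,-\alpha\}$ for all $\alpha\in\Phi$ and $W=\langle s_\alpha \mid \alpha\in\Phi\rangle$. A simple system of $\Phi$ is a minimal set of generators, taken from $\Phi^+$, of the convex cone spanned by $\Phi^+$, where $\Phi^+$ is the set of roots on one side of some hyperplane through $0$ containing no root. For a finite reflection group $G\subset O(V)$, a point $b\in V$ is called generic for $G$ if it is fixed by no reflection in $G$, and then $\mathrm{Perm}^{b}(G)=\mathrm{conv}\{g(b) \mid g\in G\}$. Let $a\in V$ be generic for $W$, let $\Delta$ be the simple system of $\Phi$ with $\langle a,\alpha\rangle>0$ for all $\alpha\in\Delta$, and let $S=\{s_\alpha\mid\alpha\in\Delta\}$. For $I\subseteq S$ let $W_I=\langle I\rangle$ (a standard parabolic subgroup) and $F_I=\mathrm{Perm}^{a}(W_I)$.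 1. Every face of dimension $k$ of $\mathrm{Perm}^a(W)$ is of the form $w(F_I)$ with $w\in W$, $I\subseteq S$ and $|I|=k$. Conversely, for all $w\in W$ and $I\subseteq S$, the set $w(F_I)$ is a face of dimension $|I|$. Moreover it is a permutahedron: $wW_Iw^{-1}$ is a finite reflection group, $w(a)$ is generic for it, and $w(F_I)=\mathrm{Perm}^{w(a)}(wW_Iw^{-1})$. 2. For $w,g\in W$ and $I\subseteq S$: $w(F_I)=g(F_I)$ if and only if $wW_I=gW_I$. 3. For $w,g\in W$ and $I,J\subseteq S$: $w(F_I)\subseteq g(F_J)$ if and only if $wW_I\subseteq gW_J$. The map $w(F_I)\mapsto wW_I$ extends to an isomorphism from the face lattice of $\mathrm{Perm}^a(W)$ (all faces, including the empty one, ordered by inclusion) onto the poset $\{wW_I\mid w\in W,\ I\subseteq S\}$, ordered by inclusion, with an additional least element adjoined (the image of the empty face). -/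

import Mathlib

open scoped Pointwise

noncomputable section

namespace PermFaces

variable {V : Type*} [NormedAddCommGroup V] [InnerProductSpace ℝ V]

/-- The orthogonal reflection `s_α` fixing the hyperplane `α^⊥` pointwise and sending `α` to `-α`
(for `α ≠ 0`), as an element of the orthogonal group `O(V) = (V ≃ₗᵢ[ℝ] V)`. -/
def rootRefl (α : V) : V ≃ₗᵢ[ℝ] V := (ℝ ∙ α)ᗮ.reflection

/-- `s` is an orthogonal reflection. -/
def IsRefl (s : V ≃ₗᵢ[ℝ] V) : Prop := ∃ α : V, α ≠ 0 ∧ s = rootRefl α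

/-- A finite reflection group: a finite subgroup of `O(V)` generated by reflections. -/
def IsFiniteReflectionGroup (W : Subgroup (V ≃ₗᵢ[ℝ] V)) : Prop :=
  Finite W ∧ ∃ R : Set (V ≃ₗᵢ[ℝ] V), (∀ s ∈ R, IsRefl s) ∧ W = Subgroup.closure R

/-- `a` is generic for `W`: it is not fixed by any reflection in `W`. -/
def IsGeneric (W : Subgroup (V ≃ₗᵢ[ℝ] V)) (a : V) : Prop :=
  ∀ s ∈ W, IsRefl s → s a ≠ a

/-- The permutahedron `Perm^a(W)`: the convex hull of the `W`-orbit of `a`. -/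
def Perm (a : V) (W : Subgroup (V ≃ₗᵢ[ℝ] V)) : Set V :=
  convexHull ℝ {x | ∃ w ∈ W, x = w a}

/-- `Φ` is a root system for `W`. (The empty set is allowed, for the trivial group.) -/
structure IsRootSystemFor (W : Subgroup (V ≃ₗᵢ[ℝ] V)) (Φ : Set V) : Prop where
  finite : Φ.Finite
  zero_notMem : (0 : V) ∉ Φ
  generates : W = Subgroup.closure (rootRefl '' Φ)
  line_inter : ∀ α ∈ Φ, ((ℝ ∙ α : Submodule ℝ V) : Set V) ∩ Φ = {α, -α}
  stable : ∀ w ∈ W, ∀ α ∈ Φ, w α ∈ Φ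

/-- `Φp` is a set of positive roots of `Φ`: the roots on one side of a linear hyperplane `ker f`
that contains no root. -/
def IsPositiveSystem (Φ Φp : Set V) : Prop :=
  ∃ f : V →ₗ[ℝ] ℝ, (∀ α ∈ Φ, f α ≠ 0) ∧ Φp = {α ∈ Φ | 0 < f α}

/-- `Δ` is a simple system of `Φ`: for some set of positive roots `Φp`, it is a basis of the
polyhedral cone generated by `Φp`, i.e. a minimal subset of `Φp` generating the same cone. -/
def IsSimpleSystem (Φ Δ : Set V) : Prop :=
  ∃ Φp : Set V, IsPositiveSystem Φ Φp ∧
    Minimal (fun D : Set V => D ⊆ Φp ∧ PointedCone.hull ℝ D = PointedCone.hull ℝ Φp) Δ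

/-- The simple reflections `S = {s_α | α ∈ Δ}`. -/
def simpleReflections (Δ : Set V) : Set (V ≃ₗᵢ[ℝ] V) := rootRefl '' Δ

/-- `F` is a nonempty set whose affine span has dimension `k`. -/
def HasDim (F : Set V) (k : ℕ) : Prop :=
  F.Nonempty ∧ Module.finrank ℝ (affineSpan ℝ F).direction = k

/-- The face lattice of the polytope `P`: all its faces, including `∅` and `P` itself, ordered by
inclusion. A nonempty face is the set of maximizers over `P` of a linear functional. -/
abbrev FaceLattice (P : Set V) : Type _ := {F : Set V // IsExposed ℝ P F}

/-- The poset, under inclusion, of the cosets `w W_I` (`w ∈ W`, `I ⊆ S`) of the standard parabolic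
subgroups `W_I = ⟨I⟩`. -/
abbrev ParabolicCosets (W : Subgroup (V ≃ₗᵢ[ℝ] V)) (S : Set (V ≃ₗᵢ[ℝ] V)) : Type _ :=
  {C : Set (V ≃ₗᵢ[ℝ] V) //
    ∃ w ∈ W, ∃ I ⊆ S, C = w • (Subgroup.closure I : Set (V ≃ₗᵢ[ℝ] V))}

end PermFaces

end

open scoped Pointwise

noncomputable section

namespace PermFaces

variable {V : Type*} [NormedAddCommGroup V] [InnerProductSpace ℝ V]

/-! ### Reflections -/

/-! A nonempty face is the set of maximizers of some `⟪l, ·⟫`. Since `W` preserves `Perm a W`, a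
translation by `W` makes `l` dominant (`exists_dominant`). Let `D` be the set of simple roots
orthogonal to `l`. If `w a` maximizes `⟪l, ·⟫` on the orbit, some `u ∈ W_D` makes `u w a`
nonnegative on `D` without changing its value. Negativity on a simple root outside `D` would let a
reflection increase that value, so `u w a` is dominant, hence `u w = 1` and `w ∈ W_D`. Thus the face
is `Perm a W_D` (`maxFace_of_dominant`).

Conversely, simple roots are linearly independent, so every `D ⊆ Δ` arises from a dominant `l`. The
same argument shows that `w a ∈ Perm a W_D` forces `w ∈ W_D`, which turns inclusions of faces into
inclusions of cosets. The differences of points of the orbit `W_D a` span `span D`, which gives the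
dimension.

The root-theoretic input is that a group element sending `a` to a dominant point is trivial
(`eq_one_of_dominant`), a consequence of the exchange condition. -/

lemma rootRefl_apply (α v : V) :
    rootRefl α v = v - (2 * (inner ℝ α v / ‖α‖ ^ 2)) • α := by
  rw [rootRefl, Submodule.reflection_orthogonal_apply, Submodule.reflection_singleton_apply]
  simp only [RCLike.ofReal_real_eq_id, id_eq, two_smul, two_mul, add_smul]
  abel

lemma rootRefl_self (α : V) : rootRefl α α = -α :=
  Submodule.reflection_orthogonalComplement_singleton_eq_neg α

lemma rootRefl_neg (α : V) : rootRefl (-α) = rootRefl α := by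
  ext v
  simp [rootRefl_apply, neg_div]

lemma rootRefl_mul_self (α : V) : rootRefl α * rootRefl α = 1 := by
  ext v
  rw [rootRefl]
  exact Submodule.reflection_reflection (ℝ ∙ α)ᗮ v

lemma rootRefl_inv (α : V) : (rootRefl α)⁻¹ = rootRefl α :=
  inv_eq_of_mul_eq_one_left (rootRefl_mul_self α)

lemma conj_rootRefl (w : V ≃ₗᵢ[ℝ] V) (α : V) : w * rootRefl α * w⁻¹ = rootRefl (w α) := by
  rw [mul_inv_eq_iff_eq_mul]
  ext v
  simp [rootRefl_apply]

lemma inner_rootRefl (α v x : V) :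
    inner ℝ x (rootRefl α v) = inner ℝ x v - 2 * (inner ℝ α v / ‖α‖ ^ 2) * inner ℝ x α := by
  rw [rootRefl_apply, inner_sub_right, inner_smul_right]

lemma inner_inv_left (w : V ≃ₗᵢ[ℝ] V) (x y : V) : inner ℝ (w⁻¹ x) y = inner ℝ x (w y) := by
  rw [← w.inner_map_map]
  congr 1
  exact w.apply_symm_apply x

lemma inner_inv_right (w : V ≃ₗᵢ[ℝ] V) (x y : V) : inner ℝ x (w⁻¹ y) = inner ℝ (w x) y := by
  rw [real_inner_comm, inner_inv_left, real_inner_comm]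

lemma exists_simple_word {Δ : Set V} {w : V ≃ₗᵢ[ℝ] V} (hw : w ∈ Subgroup.closure (rootRefl '' Δ)) :
    ∃ l : List V, (∀ α ∈ l, α ∈ Δ) ∧ (l.map rootRefl).prod = w := by
  induction hw using Subgroup.closure_induction_left with
  | one => exact ⟨[], by simp, rfl⟩
  | mul_left x hx y _ ih =>
    obtain ⟨α, hα, rfl⟩ := hx
    obtain ⟨l, hl, rfl⟩ := ih
    exact ⟨α :: l, by simpa [hα] using hl, by simp⟩
  | inv_mul_cancel x hx y _ ih =>
    obtain ⟨α, hα, rfl⟩ := hx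
    obtain ⟨l, hl, rfl⟩ := ih
    exact ⟨α :: l, by simpa [hα] using hl, by simp [rootRefl_inv]⟩

/-! ### Cones -/

lemma mem_hull_insert {x y : V} {s : Set V} :
    x ∈ PointedCone.hull ℝ (insert y s) ↔
      ∃ t : ℝ, 0 ≤ t ∧ ∃ z ∈ PointedCone.hull ℝ s, x = t • y + z := by
  rw [PointedCone.hull, Submodule.mem_span_insert]
  constructor
  · rintro ⟨t, z, hz, rfl⟩
    exact ⟨t, t.2, z, hz, rfl⟩
  · rintro ⟨t, ht, z, hz, rfl⟩
    exact ⟨⟨t, ht⟩, z, hz, rfl⟩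

lemma smul_mem_cone (C : PointedCone ℝ V) {t : ℝ} (ht : 0 ≤ t) {x : V} (hx : x ∈ C) :
    t • x ∈ C :=
  C.smul_mem ht hx

lemma mem_cone_of_smul_mem (C : PointedCone ℝ V) {t : ℝ} (ht : 0 < t) {x : V}
    (hx : t • x ∈ C) : x ∈ C := by
  simpa [smul_smul, inv_mul_cancel₀ ht.ne'] using smul_mem_cone C (inv_nonneg.2 ht.le) hx

lemma inner_nonneg_of_mem_hull {x z : V} {s : Set V} (hx : ∀ v ∈ s, 0 ≤ inner ℝ x v)
    (hz : z ∈ PointedCone.hull ℝ s) : 0 ≤ inner ℝ x z := by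
  induction hz using Submodule.span_induction with
  | mem v hv => exact hx v hv
  | zero => simp
  | add u v _ _ hu hv => rw [inner_add_right]; exact add_nonneg hu hv
  | smul t v _ hv =>
    change 0 ≤ inner ℝ x ((t : ℝ) • v)
    rw [inner_smul_right]; exact mul_nonneg t.2 hv

lemma eq_zero_of_mem_hull_of_inner_nonpos {x z : V} {s : Set V} (hx : ∀ v ∈ s, 0 < inner ℝ x v)
    (hz : z ∈ PointedCone.hull ℝ s) (h : inner ℝ x z ≤ 0) : z = 0 := by
  -- This dichotomy is preserved by sums and nonnegative multiples, so it can be proved by induction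
  -- on the cone.
  have key : z = 0 ∨ 0 < inner ℝ x z := by
    clear h
    induction hz using Submodule.span_induction with
    | mem v hv => exact .inr (hx v hv)
    | zero => exact .inl rfl
    | add u v _ _ hu hv =>
      rw [inner_add_right]
      rcases hu with rfl | hu <;> rcases hv with rfl | hv
      · simp
      · simp [hv]
      · simp [hu]
      · exact .inr (add_pos hu hv)
    | smul t v _ hv =>
      change (t : ℝ) • v = 0 ∨ 0 < inner ℝ x ((t : ℝ) • v)
      rcases hv with rfl | hv
      · simp
      · rcases t.2.eq_or_lt with ht | ht
        · left; rw [← ht, zero_smul]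
        · right; rw [inner_smul_right]; exact mul_pos ht hv
  exact key.resolve_right h.not_gt

lemma mem_hull_iff {Δ : Set V} {α x : V} (hα : α ∈ Δ) : x ∈ PointedCone.hull ℝ Δ ↔
    ∃ t : ℝ, 0 ≤ t ∧ ∃ z ∈ PointedCone.hull ℝ (Δ \ {α}), x = t • α + z := by
  rw [← mem_hull_insert, Set.insert_sdiff_singleton, Set.insert_eq_of_mem hα]

/-! ### Root systems with a simple system and a strictly dominant point -/

/-- `Δ` is a simple system of the root system `Φ`, and `a` lies in the open fundamental chamber. -/
structure IsBased (Φ Δ : Set V) (a : V) : Prop where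
  finite : Φ.Finite
  zero_notMem : (0 : V) ∉ Φ
  line : ∀ α ∈ Φ, ∀ β ∈ Φ, ∀ t : ℝ, β = t • α → β = α ∨ β = -α
  refl_mem : ∀ α ∈ Φ, ∀ β ∈ Φ, rootRefl α β ∈ Φ
  subset : Δ ⊆ Φ
  pos : ∀ α ∈ Δ, 0 < inner ℝ a α
  notMem_hull : ∀ α ∈ Δ, α ∉ PointedCone.hull ℝ (Δ \ {α})
  mem_hull_or : ∀ β ∈ Φ, β ∈ PointedCone.hull ℝ Δ ∨ -β ∈ PointedCone.hull ℝ Δ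

/-- The functional defining the positive roots is used only here; afterwards signs of roots are
measured by pairing with `a`. Minimality of `Δ` means that no simple root lies in the cone of the
others. -/
lemma isBased_of_isSimpleSystem {W : Subgroup (V ≃ₗᵢ[ℝ] V)} {Φ Δ : Set V} {a : V}
    (hΦ : IsRootSystemFor W Φ) (hΔ : IsSimpleSystem Φ Δ) (haΔ : ∀ α ∈ Δ, 0 < inner ℝ a α) :
    IsBased Φ Δ a := by
  obtain ⟨Φp, ⟨f, hf, rfl⟩, ⟨hsub, hhull⟩, hmin⟩ := hΔ
  have hrefl : ∀ α ∈ Φ, ∀ β ∈ Φ, rootRefl α β ∈ Φ := fun α hα β hβ =>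
    hΦ.stable _ (by rw [hΦ.generates]; exact Subgroup.subset_closure ⟨α, hα, rfl⟩) β hβ
  refine ⟨hΦ.finite, hΦ.zero_notMem, ?_, hrefl, fun α hα => (hsub hα).1, haΔ, ?_, ?_⟩
  · rintro α hα β hβ t rfl
    have : t • α ∈ ((ℝ ∙ α : Submodule ℝ V) : Set V) ∩ Φ :=
      ⟨Submodule.mem_span_singleton.2 ⟨t, rfl⟩, hβ⟩
    rw [hΦ.line_inter α hα] at this
    exact this
  · intro α hα h
    have hins : insert α (Δ \ {α}) = Δ := by simp [Set.insert_eq_of_mem hα]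
    have heq : PointedCone.hull ℝ (Δ \ {α}) = PointedCone.hull ℝ Δ := by
      refine le_antisymm (Submodule.span_mono Set.sdiff_subset) (Submodule.span_le.2 ?_)
      rw [← hins]
      rintro x (rfl | hx)
      · simpa using h
      · simpa using Submodule.subset_span hx
    exact (hmin ⟨Set.sdiff_subset.trans hsub, heq.trans hhull⟩ Set.sdiff_subset hα).2 rfl
  · intro β hβ
    rw [hhull]
    rcases (hf β hβ).lt_or_gt with h | h
    · right
      refine Submodule.subset_span ⟨?_, by simpa using h⟩
      simpa [rootRefl_self] using hrefl β hβ β hβ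
    · left
      exact Submodule.subset_span ⟨hβ, h⟩

namespace IsBased

variable {Φ Δ : Set V} {a : V}

lemma neg_mem (h : IsBased Φ Δ a) {β : V} (hβ : β ∈ Φ) : -β ∈ Φ := by
  simpa [rootRefl_self] using h.refl_mem β hβ β hβ

lemma ne_zero (h : IsBased Φ Δ a) {β : V} (hβ : β ∈ Φ) : β ≠ 0 := fun h0 => h.zero_notMem (h0 ▸ hβ)

lemma norm_sq_pos (h : IsBased Φ Δ a) {β : V} (hβ : β ∈ Φ) : 0 < ‖β‖ ^ 2 := by
  have := norm_pos_iff.2 (h.ne_zero hβ)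
  positivity

lemma mem_hull_of_inner_pos (h : IsBased Φ Δ a) {β : V} (hβ : β ∈ Φ) (hp : 0 < inner ℝ a β) :
    β ∈ PointedCone.hull ℝ Δ := by
  refine (h.mem_hull_or β hβ).resolve_right fun hn => ?_
  have := inner_nonneg_of_mem_hull (fun v hv => (h.pos v hv).le) hn
  rw [inner_neg_right] at this
  linarith

lemma inner_ne_zero (h : IsBased Φ Δ a) {β : V} (hβ : β ∈ Φ) : inner ℝ a β ≠ 0 := by
  intro h0
  rcases h.mem_hull_or β hβ with hc | hc
  · exact h.ne_zero hβ (eq_zero_of_mem_hull_of_inner_nonpos h.pos hc h0.le)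
  · have := eq_zero_of_mem_hull_of_inner_nonpos h.pos hc (by rw [inner_neg_right, h0, neg_zero])
    exact h.ne_zero hβ (neg_eq_zero.1 this)

/-- No positive multiple of a simple root is in the cone spanned by the other simple roots. -/
lemma nonpos_of_smul_mem (h : IsBased Φ Δ a) {α : V} (hα : α ∈ Δ) {t : ℝ}
    (ht : t • α ∈ PointedCone.hull ℝ (Δ \ {α})) : t ≤ 0 := by
  by_contra! hpos
  exact h.notMem_hull α hα (mem_cone_of_smul_mem _ hpos ht)

/-- Here `t ≤ 0` makes the pairing of `z` with `a` nonpositive, whereas `a` is strictly positive on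
the nonzero part of the cone. -/
lemma eq_zero_of_smul_mem (h : IsBased Φ Δ a) {α z : V} (hα : α ∈ Δ) {t : ℝ}
    (hz : z ∈ PointedCone.hull ℝ (Δ \ {α})) (ht : z = t • α) : z = 0 := by
  have ht0 := h.nonpos_of_smul_mem hα (ht ▸ hz)
  refine eq_zero_of_mem_hull_of_inner_nonpos (fun v hv => h.pos v hv.1) hz ?_
  rw [ht, inner_smul_right]
  exact mul_nonpos_of_nonpos_of_nonneg ht0 (h.pos α hα).le

/-- Distinct simple roots make an obtuse (or right) angle. -/
lemma inner_nonpos (h : IsBased Φ Δ a)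
    {α β : V} (hα : α ∈ Δ) (hβ : β ∈ Δ) (hne : α ≠ β) : inner ℝ α β ≤ 0 := by
  by_contra! hpos
  set c : ℝ := 2 * (inner ℝ α β / ‖α‖ ^ 2) with hc
  have hc0 : 0 < c := mul_pos two_pos (div_pos hpos (h.norm_sq_pos (h.subset hα)))
  have hr : rootRefl α β = β - c • α := rootRefl_apply α β
  have hαβ : α ∈ PointedCone.hull ℝ (Δ \ {β}) := Submodule.subset_span ⟨hα, hne⟩
  have hβα : β ∈ PointedCone.hull ℝ (Δ \ {α}) := Submodule.subset_span ⟨hβ, hne.symm⟩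
  rcases h.mem_hull_or _ (h.refl_mem α (h.subset hα) β (h.subset hβ)) with hm | hm
  -- Isolating `β` puts `c • α + z`, an element of the cone of `Δ \ {β}`, on the line of `β`. It
  -- must vanish, but its pairing with `a` is positive. The other case isolates `α` in the same way.
  · obtain ⟨t, -, z, hz, e⟩ := (mem_hull_iff hβ).1 hm
    have e' : c • α + z = (1 - t) • β := by
      rw [sub_smul, one_smul]
      rw [eq_sub_iff_add_eq, add_assoc, add_comm z, ← e, hr]
      abel
    have h0 := h.eq_zero_of_smul_mem hβ (add_mem (smul_mem_cone _ hc0.le hαβ) hz) e'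
    have h1 := inner_nonneg_of_mem_hull (x := a) (fun v hv => (h.pos v hv.1).le) hz
    have h2 : inner ℝ a (c • α + z) = 0 := by rw [h0, inner_zero_right]
    rw [inner_add_right, inner_smul_right] at h2
    have := mul_pos hc0 (h.pos α hα)
    linarith
  · obtain ⟨t, -, z, hz, e⟩ := (mem_hull_iff hα).1 hm
    have e' : β + z = (c - t) • α := by
      rw [sub_smul]
      rw [hr, neg_sub, sub_eq_iff_eq_add] at e
      rw [e]
      abel
    have h0 := h.eq_zero_of_smul_mem hα (add_mem hβα hz) e'
    have h1 := inner_nonneg_of_mem_hull (x := a) (fun v hv => (h.pos v hv.1).le) hz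
    have h2 : inner ℝ a (β + z) = 0 := by rw [h0, inner_zero_right]
    rw [inner_add_right] at h2
    have := h.pos β hβ
    linarith

/-- Separating positive from negative coefficients writes a relation as two expressions of one
vector `v`. Obtuse angles give `⟪v, v⟫ ≤ 0`, so `v = 0`, and pairing with `a` kills the positive
coefficients. Applying this to `-g` kills the negative ones. -/
lemma linearIndepOn (h : IsBased Φ Δ a) : LinearIndepOn ℝ id Δ := by
  rw [linearIndepOn_iff']
  intro s g hs hsum
  have key : ∀ g : V → ℝ, ∑ i ∈ s, g i • i = 0 → ∀ i ∈ s, g i ≤ 0 := by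
    clear hsum g
    intro g hsum
    have hpn : ∀ i, g i = max (g i) 0 - max (-g i) 0 := by
      intro i
      rcases le_total (g i) 0 with hi | hi
      · rw [max_eq_right hi, max_eq_left (by linarith)]; ring
      · rw [max_eq_left hi, max_eq_right (by linarith)]; ring
    have heq : ∑ i ∈ s, max (g i) 0 • i = ∑ i ∈ s, max (-g i) 0 • i := by
      rw [← sub_eq_zero, ← Finset.sum_sub_distrib, ← hsum]
      refine Finset.sum_congr rfl fun i _ => ?_
      rw [← sub_smul, ← hpn]
    set v := ∑ i ∈ s, max (g i) 0 • i with hv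
    have hvv : inner ℝ v v ≤ 0 := by
      nth_rewrite 2 [heq]
      rw [hv, sum_inner]
      refine Finset.sum_nonpos fun i hi => ?_
      rw [inner_sum]
      refine Finset.sum_nonpos fun j hj => ?_
      rw [inner_smul_left, inner_smul_right]
      by_cases hij : i = j
      · subst hij
        rcases le_total (g i) 0 with hi | hi
        · simp [max_eq_right hi]
        · simp [max_eq_right (neg_nonpos.2 hi)]
      · exact mul_nonpos_of_nonneg_of_nonpos (le_max_right _ _)
          (mul_nonpos_of_nonneg_of_nonpos (le_max_right _ _) (h.inner_nonpos (hs hi) (hs hj) hij))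
    have hv0 : v = 0 := real_inner_self_nonpos.1 hvv
    have hav : ∑ i ∈ s, max (g i) 0 * inner ℝ a i = 0 := by
      have : inner ℝ a v = 0 := by rw [hv0, inner_zero_right]
      rw [hv, inner_sum] at this
      simpa only [inner_smul_right] using this
    intro i hi
    rw [Finset.sum_eq_zero_iff_of_nonneg fun j hj =>
      mul_nonneg (le_max_right _ _) (h.pos j (hs hj)).le] at hav
    have := (mul_eq_zero.1 (hav i hi)).resolve_right (h.pos i (hs hi)).ne'
    exact max_eq_right_iff.1 this
  intro i hi
  refine le_antisymm (key g hsum i hi) ?_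
  have := key (fun i => -g i) (by simpa using hsum) i hi
  linarith

lemma finite_simple (h : IsBased Φ Δ a) : Δ.Finite := h.finite.subset h.subset

/-- The only positive root made negative by a simple reflection is the simple root itself. -/
lemma eq_of_rootRefl_neg (h : IsBased Φ Δ a)
    {α γ : V} (hα : α ∈ Δ) (hγ : γ ∈ Φ) (hp : 0 < inner ℝ a γ)
    (hn : inner ℝ a (rootRefl α γ) < 0) : γ = α := by
  have hrΦ := h.neg_mem (h.refl_mem α (h.subset hα) γ hγ)
  obtain ⟨c, -, z, hz, e⟩ := (mem_hull_iff hα).1 (h.mem_hull_of_inner_pos hγ hp)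
  obtain ⟨d, -, z', hz', e'⟩ := (mem_hull_iff hα).1
    (h.mem_hull_of_inner_pos hrΦ (by rw [inner_neg_right]; linarith))
  set k : ℝ := 2 * (inner ℝ α γ / ‖α‖ ^ 2)
  have hr : rootRefl α γ = γ - k • α := rootRefl_apply α γ
  -- The components of `γ` and `-s_α γ` off `α` add up to a multiple of `α`, so they vanish and `γ`
  -- is proportional to `α`.
  have hzz : z + z' = (k - c - d) • α := by
    rw [hr, neg_sub] at e'
    have : k • α = d • α + z' + (c • α + z) := by rw [← e', ← e]; abel
    rw [sub_smul, sub_smul, this]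
    abel
  have h0 := h.eq_zero_of_smul_mem hα (add_mem hz hz') hzz
  have hz0 : z = 0 := by
    refine eq_zero_of_mem_hull_of_inner_nonpos (fun v hv => h.pos v hv.1) hz ?_
    have h1 := inner_nonneg_of_mem_hull (x := a) (fun v hv => (h.pos v hv.1).le) hz'
    have h2 : inner ℝ a (z + z') = 0 := by rw [h0, inner_zero_right]
    rw [inner_add_right] at h2
    linarith
  rw [hz0, add_zero] at e
  refine (h.line α (h.subset hα) γ hγ c e).resolve_right fun hneg => ?_
  rw [hneg, inner_neg_right] at hp
  linarith [h.pos α hα]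

/-- The positive root `α` becomes negative under `s_α = s_β`, and `β` is the only positive root that
`s_β` makes negative. This identifies `|I|` with the number of simple roots involved. -/
lemma rootRefl_injOn (h : IsBased Φ Δ a) : Set.InjOn rootRefl Δ := by
  intro α hα β hβ e
  refine (h.eq_of_rootRefl_neg hβ (h.subset hα) (h.pos α hα) ?_)
  rw [← e, rootRefl_self, inner_neg_right]
  linarith [h.pos α hα]

/-! ### The group generated by the simple reflections -/

lemma mem_of_mem_closure (h : IsBased Φ Δ a)
    {w : V ≃ₗᵢ[ℝ] V} (hw : w ∈ Subgroup.closure (rootRefl '' Φ)) :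
    ∀ β ∈ Φ, w β ∈ Φ := by
  induction hw using Subgroup.closure_induction_left with
  | one => exact fun β hβ => hβ
  | mul_left x hx y _ ih =>
    obtain ⟨α, hα, rfl⟩ := hx
    exact fun β hβ => h.refl_mem α hα _ (ih β hβ)
  | inv_mul_cancel x hx y _ ih =>
    obtain ⟨α, hα, rfl⟩ := hx
    rw [rootRefl_inv]
    exact fun β hβ => h.refl_mem α hα _ (ih β hβ)

/-- Every positive root is conjugate to a simple root under the simple reflections. -/
lemma exists_simple_conj (h : IsBased Φ Δ a) {β : V} (hβ : β ∈ Φ) (hp : 0 < inner ℝ a β) :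
    ∃ w ∈ Subgroup.closure (rootRefl '' Δ), w β ∈ Δ := by
  -- A positive root of least height `⟪a, γ⟫` in the orbit is simple: otherwise some simple `δ` with
  -- `⟪γ, δ⟫ > 0` gives a lower root `s_δ γ` that is still positive.
  set T : Set V := {γ ∈ Φ | 0 < inner ℝ a γ ∧ ∃ w ∈ Subgroup.closure (rootRefl '' Δ), w β = γ}
  have hT : T.Finite := h.finite.subset fun γ hγ => hγ.1
  obtain ⟨γ, ⟨hγ, hγp, w, hw, hwγ⟩, hmin⟩ :=
    Set.exists_min_image T (fun γ => inner ℝ a γ) hT ⟨β, hβ, hp, 1, one_mem _, rfl⟩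
  refine ⟨w, hw, ?_⟩
  rw [hwγ]
  by_contra hγΔ
  have hex : ∃ δ ∈ Δ, 0 < inner ℝ γ δ := by
    by_contra! hcon
    have := inner_nonneg_of_mem_hull (x := -γ) (fun v hv => by
      rw [inner_neg_left]; linarith [hcon v hv]) (h.mem_hull_of_inner_pos hγ hγp)
    rw [inner_neg_left] at this
    exact h.ne_zero hγ (real_inner_self_nonpos.1 (by linarith))
  obtain ⟨δ, hδ, hpos⟩ := hex
  have hmem := h.refl_mem δ (h.subset hδ) γ hγ
  have hrpos : 0 < inner ℝ a (rootRefl δ γ) := by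
    refine lt_of_le_of_ne (not_lt.1 fun hlt => ?_) (h.inner_ne_zero hmem).symm
    exact hγΔ (h.eq_of_rootRefl_neg hδ hγ hγp hlt ▸ hδ)
  have := hmin (rootRefl δ γ) ⟨hmem, hrpos, rootRefl δ * w,
    mul_mem (Subgroup.subset_closure ⟨δ, hδ, rfl⟩) hw, by rw [← hwγ]; rfl⟩
  rw [inner_rootRefl] at this
  have : 0 < 2 * (inner ℝ δ γ / ‖δ‖ ^ 2) * inner ℝ a δ :=
    mul_pos (mul_pos two_pos (div_pos (by rwa [real_inner_comm])
      (h.norm_sq_pos (h.subset hδ)))) (h.pos δ hδ)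
  linarith

lemma closure_eq (h : IsBased Φ Δ a) :
    Subgroup.closure (rootRefl '' Φ) = Subgroup.closure (rootRefl '' Δ) := by
  refine le_antisymm ((Subgroup.closure_le _).2 ?_)
    (Subgroup.closure_mono (Set.image_mono h.subset))
  have key : ∀ β ∈ Φ, 0 < inner ℝ a β → rootRefl β ∈ Subgroup.closure (rootRefl '' Δ) := by
    intro β hβ hp
    obtain ⟨w, hw, hwβ⟩ := h.exists_simple_conj hβ hp
    have e : rootRefl β = w⁻¹ * rootRefl (w β) * w := by
      rw [← conj_rootRefl]; group
    rw [e]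
    exact mul_mem (mul_mem (inv_mem hw) (Subgroup.subset_closure ⟨_, hwβ, rfl⟩)) hw
  rintro _ ⟨β, hβ, rfl⟩
  rcases (h.inner_ne_zero hβ).lt_or_gt with hn | hp
  · have := key (-β) (h.neg_mem hβ) (by rw [inner_neg_right]; linarith)
    rwa [rootRefl_neg] at this
  · exact key β hβ hp

lemma list_prod_mem (h : IsBased Φ Δ a) (l : List V) (hl : ∀ α ∈ l, α ∈ Δ) :
    ∀ β ∈ Φ, (l.map rootRefl).prod β ∈ Φ := by
  induction l with
  | nil => exact fun β hβ => hβ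
  | cons γ t ih =>
    intro β hβ
    rw [List.map_cons, List.prod_cons]
    exact h.refl_mem γ (h.subset (hl γ (by simp))) _ (ih (fun α hα => hl α (by simp [hα])) β hβ)

/-- The exchange condition. -/
lemma exchange (h : IsBased Φ Δ a) {α : V} (hα : α ∈ Δ) (l : List V) (hl : ∀ β ∈ l, β ∈ Δ)
    (hneg : inner ℝ a ((l.map rootRefl).prod α) < 0) :
    ∃ l' : List V, (∀ β ∈ l', β ∈ Δ) ∧ l'.length + 1 = l.length ∧
      (l'.map rootRefl).prod = (l.map rootRefl).prod * rootRefl α := by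
  induction l with
  | nil => exact absurd (h.pos α hα) (not_lt.2 hneg.le)
  | cons β t ih =>
    have ht : ∀ γ ∈ t, γ ∈ Δ := fun γ hγ => hl γ (by simp [hγ])
    have hβ : β ∈ Δ := hl β (by simp)
    have hmem := h.list_prod_mem t ht α (h.subset hα)
    rcases (h.inner_ne_zero hmem).lt_or_gt with hn | hp
    · obtain ⟨l', hl', hlen, e⟩ := ih ht hn
      exact ⟨β :: l', by simpa [hβ] using hl', by simp [hlen], by simp [e, mul_assoc]⟩
    -- The sign changes exactly at the letter `β`, so `t α = β`, hence `s_β = t s_α t⁻¹` and `s_β t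
    -- s_α = t`.
    · have e := h.eq_of_rootRefl_neg hβ hmem hp (by simpa using hneg)
      refine ⟨t, ht, by simp, ?_⟩
      rw [List.map_cons, List.prod_cons, ← e, ← conj_rootRefl, inv_mul_cancel_right, mul_assoc,
        rootRefl_mul_self, mul_one]

/-- An element keeping all simple roots positive is trivial. -/
lemma eq_one_of_forall_pos (h : IsBased Φ Δ a)
    {w : V ≃ₗᵢ[ℝ] V} (hw : w ∈ Subgroup.closure (rootRefl '' Δ))
    (hpos : ∀ α ∈ Δ, 0 < inner ℝ a (w α)) : w = 1 := by
  -- Induction on word length: a word ending in `α` has a prefix sending `α` to a negative root, so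
  -- exchange produces a word for `w` with two fewer letters.
  have key : ∀ (n : ℕ) (l : List V), l.length = n → (∀ α ∈ l, α ∈ Δ) →
      (l.map rootRefl).prod = w → w = 1 := by
    intro n
    induction n using Nat.strong_induction_on with
    | _ n ih =>
      intro l hlen hl e
      rcases List.eq_nil_or_concat l with rfl | ⟨t, α, rfl⟩
      · simpa using e.symm
      · have hα : α ∈ Δ := hl α (by simp)
        have e' : (t.map rootRefl).prod * rootRefl α = w := by simpa using e
        have hn : inner ℝ a ((t.map rootRefl).prod α) < 0 := by
          have := hpos α hα
          rw [← e'] at this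
          change 0 < inner ℝ a ((t.map rootRefl).prod (rootRefl α α)) at this
          rw [rootRefl_self, map_neg, inner_neg_right] at this
          linarith
        obtain ⟨l', hl', hlen', e''⟩ := h.exchange hα t (fun β hβ => hl β (by simp [hβ])) hn
        simp at hlen
        exact ih l'.length (by omega) l' rfl hl' (e''.trans e')
  obtain ⟨l, hl, e⟩ := exists_simple_word hw
  exact key _ l rfl hl e

/-- An element moving `a` to a dominant point is trivial. -/
lemma eq_one_of_dominant (h : IsBased Φ Δ a)
    {w : V ≃ₗᵢ[ℝ] V} (hw : w ∈ Subgroup.closure (rootRefl '' Δ))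
    (hdom : ∀ α ∈ Δ, 0 ≤ inner ℝ α (w a)) : w = 1 := by
  refine inv_eq_one.1 (h.eq_one_of_forall_pos (inv_mem hw) fun α hα => ?_)
  have hmem : w⁻¹ α ∈ Φ :=
    h.mem_of_mem_closure (h.closure_eq ▸ inv_mem hw) α (h.subset hα)
  refine lt_of_le_of_ne ?_ (h.inner_ne_zero hmem).symm
  rw [inner_inv_right, real_inner_comm]
  exact hdom α hα

end IsBased

/-! ### Maximizers of linear functionals on convex hulls and orbits -/

/-- A point of a convex hull at which a linear functional attains its maximum over the generating
set is in the convex hull of the generators at which it does so. -/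
lemma mem_convexHull_of_max {s : Set V} {l x : V} {m : ℝ} (hs : ∀ y ∈ s, inner ℝ l y ≤ m)
    (hx : x ∈ convexHull ℝ s) (hm : m ≤ inner ℝ l x) :
    x ∈ convexHull ℝ {y ∈ s | inner ℝ l y = m} := by
  set A := convexHull ℝ {y ∈ s | inner ℝ l y = m} with hA
  have hAm : ∀ y ∈ A, inner ℝ l y = m := fun y hy =>
    convexHull_min (t := {y : V | inner ℝ l y = m}) (fun y hy => hy.2)
      (convex_hyperplane (f := fun y => inner ℝ l y) (innerₗ V l).isLinear m) hy
  -- This set contains the generators, so convexity places the whole hull in it; a point where the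
  -- maximum is attained can then only lie in `A`.
  have hconv : Convex ℝ ({y : V | inner ℝ l y < m} ∪ A) := by
    rw [convex_iff_forall_pos]
    intro y hy z hz p q hp hq hpq
    have hle : ∀ u ∈ {y : V | inner ℝ l y < m} ∪ A, inner ℝ l u ≤ m := by
      rintro u (hu | hu)
      · exact le_of_lt hu
      · exact (hAm u hu).le
    have e : inner ℝ l (p • y + q • z) = p * inner ℝ l y + q * inner ℝ l z := by
      rw [inner_add_right, inner_smul_right, inner_smul_right]
    have em : m = p * m + q * m := by rw [← add_mul, hpq, one_mul]
    rcases hy with hy | hy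
    · left
      rw [Set.mem_ofPred_eq, e, em]
      exact add_lt_add_of_lt_of_le (mul_lt_mul_of_pos_left hy hp)
        (mul_le_mul_of_nonneg_left (hle z hz) hq.le)
    · rcases hz with hz | hz
      · left
        rw [Set.mem_ofPred_eq, e, em]
        exact add_lt_add_of_le_of_lt (mul_le_mul_of_nonneg_left (hAm y hy).le hp.le)
          (mul_lt_mul_of_pos_left hz hq)
      · right
        exact convex_convexHull ℝ _ hy hz hp.le hq.le hpq
  have hsub : s ⊆ {y : V | inner ℝ l y < m} ∪ A := fun y hy =>
    (hs y hy).lt_or_eq.imp id fun e => subset_convexHull ℝ _ ⟨hy, e⟩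
  rcases convexHull_min hsub hconv hx with hlt | hA
  · exact absurd hm (not_le.2 hlt)
  · exact hA

lemma inner_eq_of_mem_closure {l x : V} {D : Set V} (hD : ∀ α ∈ D, inner ℝ l α = 0)
    {u : V ≃ₗᵢ[ℝ] V} (hu : u ∈ Subgroup.closure (rootRefl '' D)) :
    inner ℝ l (u x) = inner ℝ l x := by
  induction hu using Subgroup.closure_induction_left with
  | one => rfl
  | mul_left s hs y _ ih =>
    obtain ⟨α, hα, rfl⟩ := hs
    change inner ℝ l (rootRefl α (y x)) = _
    rw [inner_rootRefl, hD α hα, mul_zero, sub_zero, ih]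
  | inv_mul_cancel s hs y _ ih =>
    obtain ⟨α, hα, rfl⟩ := hs
    change inner ℝ l ((rootRefl α)⁻¹ (y x)) = _
    rw [rootRefl_inv, inner_rootRefl, hD α hα, mul_zero, sub_zero, ih]

lemma inner_lt_inner_rootRefl {l x α : V} (hl : 0 < inner ℝ l α) (hx : inner ℝ α x < 0) :
    inner ℝ l x < inner ℝ l (rootRefl α x) := by
  have hα : α ≠ 0 := by rintro rfl; simp at hl
  have : 0 < ‖α‖ ^ 2 := by have := norm_pos_iff.2 hα; positivity
  rw [inner_rootRefl]
  have : 2 * (inner ℝ α x / ‖α‖ ^ 2) * inner ℝ l α < 0 :=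
    mul_neg_of_neg_of_pos (mul_neg_of_pos_of_neg two_pos (div_neg_of_neg_of_pos hx this)) hl
  linarith

lemma mem_perm_self (a : V) (G : Subgroup (V ≃ₗᵢ[ℝ] V)) : a ∈ Perm a G :=
  subset_convexHull ℝ _ ⟨1, one_mem G, rfl⟩

lemma perm_mono (a : V) {G H : Subgroup (V ≃ₗᵢ[ℝ] V)} (hGH : G ≤ H) : Perm a G ⊆ Perm a H :=
  convexHull_mono fun _ ⟨g, hg, e⟩ => ⟨g, hGH hg, e⟩

/-- The right-hand side depends only on the coset `w G`; this is the link from cosets to faces. -/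
lemma image_perm (w : V ≃ₗᵢ[ℝ] V) (a : V) (G : Subgroup (V ≃ₗᵢ[ℝ] V)) :
    w '' Perm a G = convexHull ℝ ((fun g : V ≃ₗᵢ[ℝ] V => g a) '' (w • (G : Set (V ≃ₗᵢ[ℝ] V)))) := by
  have := w.toLinearEquiv.toLinearMap.image_convexHull {x | ∃ g ∈ G, x = g a}
  refine this.trans (congrArg _ ?_)
  ext x
  constructor
  · rintro ⟨_, ⟨g, hg, rfl⟩, rfl⟩
    exact ⟨w * g, Set.smul_mem_smul_set hg, rfl⟩
  · rintro ⟨_, ⟨g, hg, rfl⟩, rfl⟩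
    exact ⟨g a, ⟨g, hg, rfl⟩, rfl⟩

lemma image_perm_of_mem {w : V ≃ₗᵢ[ℝ] V} {G : Subgroup (V ≃ₗᵢ[ℝ] V)} (hw : w ∈ G) (a : V) :
    w '' Perm a G = Perm a G := by
  rw [image_perm, smul_coe_set hw, Perm]
  congr 1
  ext x
  simp [eq_comm]

/-- The maximizers over `A` of the inner product with `l`. -/
def maxFace (A : Set V) (l : V) : Set V := {x ∈ A | ∀ y ∈ A, inner ℝ l y ≤ inner ℝ l x}

lemma image_maxFace (w : V ≃ₗᵢ[ℝ] V) (A : Set V) (l : V) :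
    w '' maxFace A l = maxFace (w '' A) (w l) := by
  ext x
  constructor
  · rintro ⟨x, ⟨hx, hmax⟩, rfl⟩
    refine ⟨⟨x, hx, rfl⟩, ?_⟩
    rintro _ ⟨y, hy, rfl⟩
    simpa using hmax y hy
  · rintro ⟨⟨x, hx, rfl⟩, hmax⟩
    exact ⟨x, ⟨hx, fun y hy => by simpa using hmax _ ⟨y, hy, rfl⟩⟩, rfl⟩

lemma isExposed_maxFace (A : Set V) (l : V) : IsExposed ℝ A (maxFace A l) :=
  fun _ => ⟨innerSL ℝ l, rfl⟩

lemma _root_.IsExposed.eq_maxFace [FiniteDimensional ℝ V] {A F : Set V} (hF : IsExposed ℝ A F)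
    (hne : F.Nonempty) : ∃ l : V, F = maxFace A l := by
  obtain ⟨f, rfl⟩ := hF hne
  refine ⟨(InnerProductSpace.toDual ℝ V).symm f, ?_⟩
  simp [maxFace]

/-! ### Faces of the permutahedron and parabolic subgroups -/

namespace IsBased

variable {Φ Δ : Set V} {a : V}

/-- Choose `u` maximizing `⟪a, u x⟫`: a negative pairing with some `α ∈ D` could be improved by
applying `s_α`. -/
lemma exists_dominant (h : IsBased Φ Δ a)
    {D : Set V} (hD : D ⊆ Δ) [Finite (Subgroup.closure (rootRefl '' D))]
    (x : V) : ∃ u ∈ Subgroup.closure (rootRefl '' D), ∀ α ∈ D, 0 ≤ inner ℝ α (u x) := by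
  obtain ⟨⟨u, hu⟩, hmax⟩ := Finite.exists_max
    (fun u : Subgroup.closure (rootRefl '' D) => inner ℝ a ((u : V ≃ₗᵢ[ℝ] V) x))
  refine ⟨u, hu, fun α hα => ?_⟩
  by_contra! hneg
  exact (inner_lt_inner_rootRefl (h.pos α (hD hα)) hneg).not_ge
    (hmax ⟨rootRefl α * u, mul_mem (Subgroup.subset_closure ⟨α, hα, rfl⟩) hu⟩)

/-- If `l` is dominant, the maximizers of `⟪l, ·⟫` on the orbit of `a` are in the orbit of `a` under
the parabolic subgroup generated by the simple reflections fixing `l`. -/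
lemma mem_closure_of_max (h : IsBased Φ Δ a) [Finite (Subgroup.closure (rootRefl '' Δ))] {l : V}
    (hl : ∀ α ∈ Δ, 0 ≤ inner ℝ l α) {w : V ≃ₗᵢ[ℝ] V}
    (hw : w ∈ Subgroup.closure (rootRefl '' Δ))
    (hmax : ∀ g ∈ Subgroup.closure (rootRefl '' Δ), inner ℝ l (g a) ≤ inner ℝ l (w a)) :
    w ∈ Subgroup.closure (rootRefl '' {α ∈ Δ | inner ℝ l α = 0}) := by
  set D := {α ∈ Δ | inner ℝ l α = 0} with hDdef
  have hD : D ⊆ Δ := fun α hα => hα.1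
  have hle : Subgroup.closure (rootRefl '' D) ≤ Subgroup.closure (rootRefl '' Δ) :=
    Subgroup.closure_mono (Set.image_mono hD)
  have : Finite (Subgroup.closure (rootRefl '' D)) :=
    Finite.of_injective _ (Subgroup.inclusion_injective hle)
  obtain ⟨u, hu, hdom⟩ := h.exists_dominant hD (w a)
  have huw : u * w = 1 := by
    refine h.eq_one_of_dominant (mul_mem (hle hu) hw) fun α hα => ?_
    by_cases hαD : α ∈ D
    · exact hdom α hαD
    · have hpos : 0 < inner ℝ l α := lt_of_le_of_ne (hl α hα) fun e => hαD ⟨hα, e.symm⟩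
      by_contra! hneg
      have hlt := inner_lt_inner_rootRefl hpos hneg
      have h1 := hmax (rootRefl α * (u * w))
        (mul_mem (Subgroup.subset_closure ⟨α, hα, rfl⟩) (mul_mem (hle hu) hw))
      have h2 : inner ℝ l ((u * w) a) = inner ℝ l (w a) :=
        inner_eq_of_mem_closure (x := w a) (fun α hα => hα.2) hu
      rw [h2] at hlt
      exact hlt.not_ge h1
  rw [← inv_eq_of_mul_eq_one_right huw]
  exact inv_mem hu

/-- Some `w a` is maximal on the finite orbit. By the preceding lemma `w` is generated by
reflections fixing `l`, so the value at `a` is the same. -/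
lemma inner_le_of_dominant (h : IsBased Φ Δ a) [Finite (Subgroup.closure (rootRefl '' Δ))] {l : V}
    (hl : ∀ α ∈ Δ, 0 ≤ inner ℝ l α) :
    ∀ g ∈ Subgroup.closure (rootRefl '' Δ), inner ℝ l (g a) ≤ inner ℝ l a := by
  obtain ⟨⟨w, hw⟩, hmax⟩ := Finite.exists_max
    (fun u : Subgroup.closure (rootRefl '' Δ) => inner ℝ l ((u : V ≃ₗᵢ[ℝ] V) a))
  have hmem := h.mem_closure_of_max hl hw fun g hg => hmax ⟨g, hg⟩
  intro g hg
  rw [← inner_eq_of_mem_closure (x := a) (fun α hα => hα.2) hmem]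
  exact hmax ⟨g, hg⟩

lemma maxFace_of_dominant (h : IsBased Φ Δ a) [Finite (Subgroup.closure (rootRefl '' Δ))] {l : V}
    (hl : ∀ α ∈ Δ, 0 ≤ inner ℝ l α) :
    maxFace (Perm a (Subgroup.closure (rootRefl '' Δ))) l =
      Perm a (Subgroup.closure (rootRefl '' {α ∈ Δ | inner ℝ l α = 0})) := by
  have hle : ∀ y ∈ Perm a (Subgroup.closure (rootRefl '' Δ)), inner ℝ l y ≤ inner ℝ l a :=
    fun y hy => convexHull_min (t := {y : V | inner ℝ l y ≤ inner ℝ l a})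
      (by rintro _ ⟨g, hg, rfl⟩; exact h.inner_le_of_dominant hl g hg)
      (convex_halfSpace_le (f := fun y => inner ℝ l y) (innerₗ V l).isLinear _) hy
  ext x
  constructor
  · rintro ⟨hx, hmax⟩
    refine convexHull_mono ?_ (mem_convexHull_of_max (m := inner ℝ l a) ?_ hx
      (hmax a (mem_perm_self a _)))
    · rintro _ ⟨⟨g, hg, rfl⟩, e⟩
      refine ⟨g, h.mem_closure_of_max hl hg fun u hu => ?_, rfl⟩
      rw [e]
      exact h.inner_le_of_dominant hl u hu
    · rintro _ ⟨g, hg, rfl⟩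
      exact h.inner_le_of_dominant hl g hg
  · intro hx
    refine ⟨perm_mono a (Subgroup.closure_mono (Set.image_mono fun α hα => hα.1)) hx,
      fun y hy => ?_⟩
    have e : inner ℝ l x = inner ℝ l a :=
      convexHull_min (t := {y : V | inner ℝ l y = inner ℝ l a})
        (by
          rintro _ ⟨g, hg, rfl⟩
          exact inner_eq_of_mem_closure (fun α hα => hα.2) hg)
        (convex_hyperplane (f := fun y => inner ℝ l y) (innerₗ V l).isLinear _) hx
    rw [e]
    exact hle y hy

/-- For every set `D` of simple roots there is a dominant vector orthogonal to exactly the simple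
roots in `D`. -/
lemma exists_dominant_orthogonal (h : IsBased Φ Δ a)
    [FiniteDimensional ℝ V] {D : Set V} (hD : D ⊆ Δ) :
    ∃ l : V, (∀ α ∈ Δ, 0 ≤ inner ℝ l α) ∧ {α ∈ Δ | inner ℝ l α = 0} = D := by
  classical
  -- Linear independence allows a functional with value `0` on `D` and `1` on the other simple
  -- roots; `l` is its Riesz representative.
  let b := Module.Basis.extend h.linearIndepOn
  let f : V →ₗ[ℝ] ℝ := b.constr ℝ fun i => if (i : V) ∈ D then 0 else 1
  have hf : ∀ α ∈ Δ, f α = if α ∈ D then 0 else 1 := by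
    intro α hα
    have e := b.constr_basis ℝ (fun i => if (i : V) ∈ D then (0 : ℝ) else 1)
      ⟨α, Module.Basis.subset_extend h.linearIndepOn hα⟩
    rwa [Module.Basis.extend_apply_self] at e
  have hl : ∀ α ∈ Δ, inner ℝ ((InnerProductSpace.toDual ℝ V).symm f.toContinuousLinearMap) α =
      if α ∈ D then 0 else 1 := by
    intro α hα
    rw [InnerProductSpace.toDual_symm_apply, ← hf α hα]
    rfl
  refine ⟨(InnerProductSpace.toDual ℝ V).symm f.toContinuousLinearMap, fun α hα => ?_, ?_⟩
  · rw [hl α hα]; split_ifs <;> norm_num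
  · ext α
    constructor
    · rintro ⟨hα, e⟩
      rw [hl α hα] at e
      by_contra hn
      simp [hn] at e
    · intro hα
      exact ⟨hD hα, by rw [hl α (hD hα), if_pos hα]⟩

/-- Translates of parabolic orbit polytopes are faces. -/
lemma isExposed_image_perm (h : IsBased Φ Δ a)
    [FiniteDimensional ℝ V] [Finite (Subgroup.closure (rootRefl '' Δ))]
    {D : Set V} (hD : D ⊆ Δ) {w : V ≃ₗᵢ[ℝ] V} (hw : w ∈ Subgroup.closure (rootRefl '' Δ)) :
    IsExposed ℝ (Perm a (Subgroup.closure (rootRefl '' Δ)))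
      (w '' Perm a (Subgroup.closure (rootRefl '' D))) := by
  obtain ⟨l, hl, rfl⟩ := h.exists_dominant_orthogonal hD
  rw [← h.maxFace_of_dominant hl, image_maxFace, image_perm_of_mem hw]
  exact isExposed_maxFace _ _

/-- All nonempty faces are translates of parabolic orbit polytopes. -/
lemma exists_eq_image_perm (h : IsBased Φ Δ a)
    [FiniteDimensional ℝ V] [Finite (Subgroup.closure (rootRefl '' Δ))]
    {F : Set V} (hF : IsExposed ℝ (Perm a (Subgroup.closure (rootRefl '' Δ))) F)
    (hne : F.Nonempty) : ∃ w ∈ Subgroup.closure (rootRefl '' Δ), ∃ D ⊆ Δ,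
      F = w '' Perm a (Subgroup.closure (rootRefl '' D)) := by
  obtain ⟨l, rfl⟩ := hF.eq_maxFace hne
  obtain ⟨u, hu, hdom⟩ := h.exists_dominant subset_rfl l
  refine ⟨u⁻¹, inv_mem hu, {α ∈ Δ | inner ℝ (u l) α = 0}, fun α hα => hα.1, ?_⟩
  rw [← h.maxFace_of_dominant fun α hα => by rw [real_inner_comm]; exact hdom α hα,
    image_maxFace, image_perm_of_mem (inv_mem hu)]
  congr 1
  exact (u.symm_apply_apply l).symm

/-- With `l` dominant and orthogonal to exactly `D`, the hypothesis says that `w a` maximizes `⟪l,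
·⟫`. Thus the parabolic subgroup can be recovered from its polytope. -/
lemma mem_closure_of_apply_mem_perm (h : IsBased Φ Δ a) [FiniteDimensional ℝ V]
    [Finite (Subgroup.closure (rootRefl '' Δ))] {D : Set V} (hD : D ⊆ Δ) {w : V ≃ₗᵢ[ℝ] V}
    (hw : w ∈ Subgroup.closure (rootRefl '' Δ))
    (hmem : w a ∈ Perm a (Subgroup.closure (rootRefl '' D))) :
    w ∈ Subgroup.closure (rootRefl '' D) := by
  obtain ⟨l, hl, rfl⟩ := h.exists_dominant_orthogonal hD
  rw [← h.maxFace_of_dominant hl] at hmem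
  exact h.mem_closure_of_max hl hw fun g hg =>
    hmem.2 _ (subset_convexHull ℝ _ ⟨g, hg, rfl⟩)

lemma image_perm_subset_iff (h : IsBased Φ Δ a)
    [FiniteDimensional ℝ V] [Finite (Subgroup.closure (rootRefl '' Δ))]
    {D E : Set V} (hD : D ⊆ Δ) (hE : E ⊆ Δ) {w g : V ≃ₗᵢ[ℝ] V}
    (hw : w ∈ Subgroup.closure (rootRefl '' Δ)) (hg : g ∈ Subgroup.closure (rootRefl '' Δ)) :
    w '' Perm a (Subgroup.closure (rootRefl '' D)) ⊆
        g '' Perm a (Subgroup.closure (rootRefl '' E)) ↔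
      w • (Subgroup.closure (rootRefl '' D) : Set (V ≃ₗᵢ[ℝ] V)) ⊆
        g • (Subgroup.closure (rootRefl '' E) : Set (V ≃ₗᵢ[ℝ] V)) := by
  constructor
  · rintro hsub _ ⟨u, hu, rfl⟩
    have huΔ := Subgroup.closure_mono (Set.image_mono hD) hu
    obtain ⟨y, hy, e⟩ := hsub ⟨u a, subset_convexHull ℝ _ ⟨u, hu, rfl⟩, rfl⟩
    have e' : (g⁻¹ * (w * u)) a = y := by
      change g⁻¹ (w (u a)) = y
      rw [← e]
      exact g.symm_apply_apply y
    rw [Set.mem_smul_set_iff_inv_smul_mem]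
    exact h.mem_closure_of_apply_mem_perm hE (mul_mem (inv_mem hg) (mul_mem hw huΔ)) (e' ▸ hy)
  · intro hsub
    rw [image_perm, image_perm]
    exact convexHull_mono (Set.image_mono hsub)

lemma image_perm_eq_iff (h : IsBased Φ Δ a)
    [FiniteDimensional ℝ V] [Finite (Subgroup.closure (rootRefl '' Δ))]
    {D E : Set V} (hD : D ⊆ Δ) (hE : E ⊆ Δ) {w g : V ≃ₗᵢ[ℝ] V}
    (hw : w ∈ Subgroup.closure (rootRefl '' Δ)) (hg : g ∈ Subgroup.closure (rootRefl '' Δ)) :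
    w '' Perm a (Subgroup.closure (rootRefl '' D)) =
        g '' Perm a (Subgroup.closure (rootRefl '' E)) ↔
      w • (Subgroup.closure (rootRefl '' D) : Set (V ≃ₗᵢ[ℝ] V)) =
        g • (Subgroup.closure (rootRefl '' E) : Set (V ≃ₗᵢ[ℝ] V)) := by
  rw [subset_antisymm_iff, subset_antisymm_iff, h.image_perm_subset_iff hD hE hw hg,
    h.image_perm_subset_iff hE hD hg hw]

/-- Each `s_α` moves points along `α`, which bounds the direction above. Conversely `a - s_α a` is a
nonzero multiple of `α` because `⟪a, α⟫ > 0`. -/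
lemma direction_affineSpan_perm (h : IsBased Φ Δ a) {D : Set V} (hD : D ⊆ Δ) :
    (affineSpan ℝ (Perm a (Subgroup.closure (rootRefl '' D)))).direction =
      Submodule.span ℝ D := by
  rw [Perm, affineSpan_convexHull, direction_affineSpan]
  apply le_antisymm
  · have ha : a ∈ {x | ∃ w ∈ Subgroup.closure (rootRefl '' D), x = w a} := ⟨1, one_mem _, rfl⟩
    rw [vectorSpan_eq_span_vsub_set_right ℝ ha, Submodule.span_le]
    rintro _ ⟨_, ⟨g, hg, rfl⟩, rfl⟩
    change g a - a ∈ Submodule.span ℝ D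
    have step : ∀ α ∈ D, ∀ y : V ≃ₗᵢ[ℝ] V, y a - a ∈ Submodule.span ℝ D →
        rootRefl α (y a) - a ∈ Submodule.span ℝ D := by
      intro α hα y hy
      rw [rootRefl_apply, sub_right_comm]
      exact sub_mem hy (Submodule.smul_mem _ _ (Submodule.subset_span hα))
    induction hg using Subgroup.closure_induction_left with
    | one => simp
    | mul_left s hs y _ ih =>
      obtain ⟨α, hα, rfl⟩ := hs
      exact step α hα y ih
    | inv_mul_cancel s hs y _ ih =>
      obtain ⟨α, hα, rfl⟩ := hs
      rw [rootRefl_inv]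
      exact step α hα y ih
  · rw [Submodule.span_le]
    intro α hα
    have hmem := vsub_mem_vectorSpan ℝ
      (s := {x | ∃ w ∈ Subgroup.closure (rootRefl '' D), x = w a}) (p₁ := a)
      (p₂ := rootRefl α a) ⟨1, one_mem _, rfl⟩
      ⟨rootRefl α, Subgroup.subset_closure ⟨α, hα, rfl⟩, rfl⟩
    rw [vsub_eq_sub, rootRefl_apply, sub_sub_cancel] at hmem
    have hpos := h.pos α (hD hα)
    rw [real_inner_comm] at hpos
    have hc := h.norm_sq_pos (h.subset (hD hα))
    exact (Submodule.smul_mem_iff _ (by positivity)).1 hmem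

lemma hasDim_image_perm (h : IsBased Φ Δ a) {D : Set V} (hD : D ⊆ Δ) (w : V ≃ₗᵢ[ℝ] V) :
    HasDim (w '' Perm a (Subgroup.closure (rootRefl '' D))) (rootRefl '' D).ncard := by
  refine ⟨⟨w a, a, mem_perm_self a _, rfl⟩, ?_⟩
  have e := AffineMap.map_vectorSpan (w.toLinearEquiv.toLinearMap.toAffineMap)
    (s := Perm a (Subgroup.closure (rootRefl '' D)))
  have hfin := h.finite_simple.subset hD
  have := hfin.fintype
  rw [direction_affineSpan]
  have e' : vectorSpan ℝ (w '' Perm a (Subgroup.closure (rootRefl '' D))) =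
      (Submodule.span ℝ D).map w.toLinearEquiv.toLinearMap := by
    rw [← h.direction_affineSpan_perm hD, direction_affineSpan]
    exact e.symm
  rw [e', LinearEquiv.finrank_map_eq, finrank_span_set_eq_card
    ((h.linearIndepOn.mono hD).linearIndependent), (h.rootRefl_injOn.mono hD).ncard_image,
    Set.ncard_eq_toFinset_card']

end IsBased

/-! ### Conjugates of reflection groups -/

lemma IsRefl.conj {s : V ≃ₗᵢ[ℝ] V} (hs : IsRefl s) (w : V ≃ₗᵢ[ℝ] V) : IsRefl (w * s * w⁻¹) := by
  obtain ⟨α, hα, rfl⟩ := hs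
  exact ⟨w α, by simpa using hα, conj_rootRefl w α⟩

lemma isFiniteReflectionGroup_map_conj {R : Set (V ≃ₗᵢ[ℝ] V)} (hR : ∀ s ∈ R, IsRefl s)
    [Finite (Subgroup.closure R)] (w : V ≃ₗᵢ[ℝ] V) :
    IsFiniteReflectionGroup ((Subgroup.closure R).map (MulAut.conj w).toMonoidHom) := by
  refine ⟨Set.Finite.to_subtype ?_, (MulAut.conj w).toMonoidHom '' R, ?_, MonoidHom.map_closure _ _⟩
  · rw [Subgroup.coe_map]
    exact (Set.toFinite _).image _
  · rintro _ ⟨s, hs, rfl⟩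
    exact (hR s hs).conj w

lemma IsGeneric.map_conj {W G : Subgroup (V ≃ₗᵢ[ℝ] V)} {a : V} (ha : IsGeneric W a) (hG : G ≤ W)
    (w : V ≃ₗᵢ[ℝ] V) : IsGeneric (G.map (MulAut.conj w).toMonoidHom) (w a) := by
  rintro _ ⟨g, hg, rfl⟩ hs hfix
  have hg' : IsRefl g := by
    have := hs.conj w⁻¹
    simpa [mul_assoc] using this
  refine ha g (hG hg) hg' (w.injective ?_)
  have e : (w * g * w⁻¹) (w a) = w (g a) := congrArg (fun x => w (g x)) (w.symm_apply_apply a)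
  exact e.symm.trans hfix

lemma image_perm_eq_perm_map_conj (w : V ≃ₗᵢ[ℝ] V) (a : V) (G : Subgroup (V ≃ₗᵢ[ℝ] V)) :
    w '' Perm a G = Perm (w a) (G.map (MulAut.conj w).toMonoidHom) := by
  refine (w.toLinearEquiv.toLinearMap.image_convexHull {x | ∃ g ∈ G, x = g a}).trans
    (congrArg _ ?_)
  have e : ∀ g : V ≃ₗᵢ[ℝ] V, (w * g * w⁻¹) (w a) = w (g a) := fun g =>
    congrArg (fun x => w (g x)) (w.symm_apply_apply a)
  ext x
  constructor
  · rintro ⟨_, ⟨g, hg, rfl⟩, rfl⟩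
    exact ⟨w * g * w⁻¹, ⟨g, hg, rfl⟩, (e g).symm⟩
  · rintro ⟨_, ⟨g, hg, rfl⟩, rfl⟩
    exact ⟨g a, ⟨g, hg, rfl⟩, (e g).symm⟩

/-! ### The face lattice -/

/-- The convex hull of the points `g a`, for `g` in a coset of a parabolic subgroup. -/
def cosetHull (a : V) (C : Set (V ≃ₗᵢ[ℝ] V)) : Set V := convexHull ℝ ((fun g => g a) '' C)

/-- The isomorphism is built from cosets to faces, where no representative has to be chosen, and
then inverted. The inclusion criterion makes it an order embedding, and the classification of faces
makes it surjective. -/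
lemma IsBased.exists_faceLattice_orderIso [FiniteDimensional ℝ V] {Φ Δ : Set V} {a : V}
    (h : IsBased Φ Δ a) [Finite (Subgroup.closure (rootRefl '' Δ))] :
    ∃ e : FaceLattice (Perm a (Subgroup.closure (rootRefl '' Δ))) ≃o
        WithBot (ParabolicCosets (Subgroup.closure (rootRefl '' Δ)) (rootRefl '' Δ)),
      ∀ (C : ParabolicCosets (Subgroup.closure (rootRefl '' Δ)) (rootRefl '' Δ))
        (F : FaceLattice (Perm a (Subgroup.closure (rootRefl '' Δ)))),
        (F : Set V) = cosetHull a C → e F = (C : WithBot _) := by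
  set W := Subgroup.closure (rootRefl '' Δ) with hW
  have hcoset : ∀ C : ParabolicCosets W (rootRefl '' Δ), ∃ w ∈ W, ∃ D ⊆ Δ,
      (C : Set (V ≃ₗᵢ[ℝ] V)) = w • (Subgroup.closure (rootRefl '' D) : Set (V ≃ₗᵢ[ℝ] V)) ∧
      cosetHull a C = w '' Perm a (Subgroup.closure (rootRefl '' D)) := by
    rintro ⟨_, w, hw, I, hI, rfl⟩
    obtain ⟨D, hD, rfl⟩ := Set.subset_image_iff.1 hI
    exact ⟨w, hw, D, hD, rfl, (image_perm w a _).symm⟩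
  have hexp : ∀ C : ParabolicCosets W (rootRefl '' Δ),
      IsExposed ℝ (Perm a W) (cosetHull a C) := by
    intro C
    obtain ⟨w, hw, D, hD, -, e⟩ := hcoset C
    rw [e]
    exact h.isExposed_image_perm hD hw
  have hne : ∀ C : ParabolicCosets W (rootRefl '' Δ), (cosetHull a C).Nonempty := by
    intro C
    obtain ⟨w, hw, D, hD, -, e⟩ := hcoset C
    rw [e]
    exact ⟨w a, a, mem_perm_self a _, rfl⟩
  have hle : ∀ C C' : ParabolicCosets W (rootRefl '' Δ),
      cosetHull a C ⊆ cosetHull a C' ↔ C ≤ C' := by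
    intro C C'
    obtain ⟨w, hw, D, hD, eC, e⟩ := hcoset C
    obtain ⟨w', hw', D', hD', eC', e'⟩ := hcoset C'
    rw [e, e', h.image_perm_subset_iff hD hD' hw hw', ← eC, ← eC']
    rfl
  let φ : WithBot (ParabolicCosets W (rootRefl '' Δ)) → FaceLattice (Perm a W) :=
    WithBot.recBotCoe ⟨∅, fun hempty => absurd hempty Set.not_nonempty_empty⟩
      fun C => ⟨cosetHull a C, hexp C⟩
  have hφ : ∀ x y, φ x ≤ φ y ↔ x ≤ y := by
    intro x y
    induction x using WithBot.recBotCoe with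
    | bot => exact iff_of_true (Set.empty_subset _) bot_le
    | coe C =>
      induction y using WithBot.recBotCoe with
      | bot =>
        refine iff_of_false (fun hsub => ?_) (WithBot.not_coe_le_bot C)
        obtain ⟨x, hx⟩ := hne C
        exact hsub hx
      | coe C' => rw [WithBot.coe_le_coe]; exact hle C C'
  have hsurj : Function.Surjective φ := by
    rintro ⟨F, hF⟩
    rcases F.eq_empty_or_nonempty with rfl | hFne
    · exact ⟨⊥, rfl⟩
    · obtain ⟨w, hw, D, hD, rfl⟩ := h.exists_eq_image_perm hF hFne
      let C : ParabolicCosets W (rootRefl '' Δ) :=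
        ⟨w • (Subgroup.closure (rootRefl '' D) : Set (V ≃ₗᵢ[ℝ] V)), w, hw, rootRefl '' D,
          Set.image_mono hD, rfl⟩
      refine ⟨WithBot.some C, Subtype.ext ?_⟩
      exact (image_perm w a _).symm
  let e : WithBot (ParabolicCosets W (rootRefl '' Δ)) ≃o FaceLattice (Perm a W) :=
    RelIso.ofSurjective (OrderEmbedding.ofMapLEIff φ hφ) hsurj
  refine ⟨e.symm, fun C F hF => ?_⟩
  rw [OrderIso.symm_apply_eq]
  exact Subtype.ext hF

end PermFaces

end

open PermFaces in
theorem mainTheorem3 {V : Type*} [NormedAddCommGroup V] [InnerProductSpace ℝ V]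
    [FiniteDimensional ℝ V]
    (W : Subgroup (V ≃ₗᵢ[ℝ] V)) (hW : IsFiniteReflectionGroup W)
    (Φ : Set V) (hΦ : IsRootSystemFor W Φ)
    (a : V) (ha : IsGeneric W a)
    (Δ : Set V) (hΔ : IsSimpleSystem Φ Δ) (haΔ : ∀ α ∈ Δ, 0 < inner ℝ a α)
    (S : Set (V ≃ₗᵢ[ℝ] V)) (hS : S = simpleReflections Δ) :
    -- every `k`-dimensional face is `w(F_I)` with `|I| = k`
    (∀ (k : ℕ) (F : Set V), IsExposed ℝ (Perm a W) F → HasDim F k →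
      ∃ w ∈ W, ∃ I ⊆ S, I.ncard = k ∧ F = w '' Perm a (Subgroup.closure I)) ∧
    -- conversely, each `w(F_I)` is a face of dimension `|I|`, and it is the permutahedron of the
    -- finite reflection group `w W_I w⁻¹` at the generic point `w(a)`
    (∀ w ∈ W, ∀ I ⊆ S,
      IsExposed ℝ (Perm a W) (w '' Perm a (Subgroup.closure I)) ∧
      HasDim (w '' Perm a (Subgroup.closure I)) I.ncard ∧
      IsFiniteReflectionGroup ((Subgroup.closure I).map (MulAut.conj w).toMonoidHom) ∧
      IsGeneric ((Subgroup.closure I).map (MulAut.conj w).toMonoidHom) (w a) ∧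
      w '' Perm a (Subgroup.closure I) =
        Perm (w a) ((Subgroup.closure I).map (MulAut.conj w).toMonoidHom)) ∧
    -- equality of faces and of cosets
    (∀ w ∈ W, ∀ g ∈ W, ∀ I ⊆ S,
      w '' Perm a (Subgroup.closure I) = g '' Perm a (Subgroup.closure I) ↔
        w • (Subgroup.closure I : Set (V ≃ₗᵢ[ℝ] V)) =
          g • (Subgroup.closure I : Set (V ≃ₗᵢ[ℝ] V))) ∧
    -- inclusion of faces and of cosets
    (∀ w ∈ W, ∀ g ∈ W, ∀ I ⊆ S, ∀ J ⊆ S,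
      w '' Perm a (Subgroup.closure I) ⊆ g '' Perm a (Subgroup.closure J) ↔
        w • (Subgroup.closure I : Set (V ≃ₗᵢ[ℝ] V)) ⊆
          g • (Subgroup.closure J : Set (V ≃ₗᵢ[ℝ] V))) ∧
    -- the face lattice is the poset of cosets, with a least element added for the empty face
    (∃ e : FaceLattice (Perm a W) ≃o WithBot (ParabolicCosets W S),
      ∀ (w : V ≃ₗᵢ[ℝ] V) (hw : w ∈ W) (I : Set (V ≃ₗᵢ[ℝ] V)) (hI : I ⊆ S)
        (F : FaceLattice (Perm a W)), (F : Set V) = w '' Perm a (Subgroup.closure I) →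
        e F = ((⟨w • (Subgroup.closure I : Set (V ≃ₗᵢ[ℝ] V)), w, hw, I, hI, rfl⟩ :
          ParabolicCosets W S) : WithBot (ParabolicCosets W S))) := by
  have h := isBased_of_isSimpleSystem hΦ hΔ haΔ
  -- Simple reflections generate `W`, so subsets `I ⊆ S` can be replaced by subsets `D ⊆ Δ`
  -- throughout.
  obtain rfl : W = Subgroup.closure (rootRefl '' Δ) := hΦ.generates.trans h.closure_eq
  obtain rfl : S = rootRefl '' Δ := hS
  have hfin : Finite (Subgroup.closure (rootRefl '' Δ)) := hW.1
  refine ⟨fun k F hF hk => ?_, fun w hw I hI => ?_, fun w hw g hg I hI => ?_,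
    fun w hw g hg I hI J hJ => ?_, ?_⟩
  · obtain ⟨w, hw, D, hD, rfl⟩ := h.exists_eq_image_perm hF hk.1
    exact ⟨w, hw, rootRefl '' D, Set.image_mono hD,
      (h.hasDim_image_perm hD w).2.symm.trans hk.2, rfl⟩
  · have hle : Subgroup.closure I ≤ Subgroup.closure (rootRefl '' Δ) := Subgroup.closure_mono hI
    have : Finite (Subgroup.closure I) :=
      Finite.of_injective _ (Subgroup.inclusion_injective hle)
    obtain ⟨D, hD, rfl⟩ := Set.subset_image_iff.1 hI
    refine ⟨h.isExposed_image_perm hD hw, h.hasDim_image_perm hD w,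
      isFiniteReflectionGroup_map_conj ?_ w, ha.map_conj hle w, image_perm_eq_perm_map_conj w a _⟩
    rintro _ ⟨α, hα, rfl⟩
    exact ⟨α, h.ne_zero (h.subset (hD hα)), rfl⟩
  · obtain ⟨D, hD, rfl⟩ := Set.subset_image_iff.1 hI
    exact h.image_perm_eq_iff hD hD hw hg
  · obtain ⟨D, hD, rfl⟩ := Set.subset_image_iff.1 hI
    obtain ⟨E, hE, rfl⟩ := Set.subset_image_iff.1 hJ
    exact h.image_perm_subset_iff hD hE hw hg
  · obtain ⟨e, he⟩ := h.exists_faceLattice_orderIso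
    exact ⟨e, fun w hw I hI F hF => he ⟨_, w, hw, I, hI, rfl⟩ F (hF.trans (image_perm w a _))⟩
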